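/- Let $W$ be a one-dimensional real Brownian motion on a probability space $(\Omega,\mathscr F,\mathbb P)$, let $s>\frac12$, let $\sigma\le 2$ be a nonnegative integer, let $T>0$, $N\in\mathbb N^+$, $\delta t=T/N$, $t_n=n\,\delta t$ and $\delta W_n=W(t_{n+1})-W(t_n)$. Consider in $H^s(\mathbb R;\mathbb C)$ the mid-point scheme $$ \mathrm i\,\frac{u^{n+1}-u^n}{\delta t}+\frac{\delta W_n}{\delta t}\,\Delta u^{n+\frac12}+|u^{n+\frac12}|^{2\sigma}u^{n+\frac12}=0,\qquad u^{n+\frac12}=\tfrac12(u^n+u^{n+1}),\qquad 0\le n\le N-1, $$ where the equation is understood in the sense of tempered distributions on $\mathbb R$. 1. (Symplectic structure.) For almost every $\omega$, let $D(\omega)\subseteq H^s$ be an open set of initial data and let $v\mapsto u^n(\omega,v)\in H^s$, $v\in D(\omega)$, $0\le n\le N$, be a phase flow of the scheme, i.e. $u^0(\omega,v)=v$ and $(u^n(\omega,v))_{0\le n\le N}$ solves the scheme along $\omega$ for every $v\in D(\omega)$. Write $p^n=\operatorname{Re}u^n$, $q^n=\operatorname{Im}u^n$, let $dp^n$, $dq^n$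 be their differentials with respect to the initial datum $v$, and let $$ \bar\omega^n=\int_{\mathbb R}dp^n\wedge dq^n\,dx,\qquad \bar\omega^n_v(h,k)=\int_{\mathbb R}\bigl(dp^n_v(h)\,dq^n_v(k)-dp^n_v(k)\,dq^n_v(h)\bigr)\,dx,\quad h,k\in H^s . $$ Then, almost surely, for all $0\le n\le N-1$ one has $\bar\omega^{n+1}_v=\bar\omega^n_v$ at every $v\in D(\omega)$ at which the two maps $u^n(\omega,\cdot)$ and $u^{n+1}(\omega,\cdot)$ are (real) Fréchet differentiable from $H^s$ to $H^s$. 2. (Charge.) If random elements $u^0,\dots,u^N$ of $H^s$ solve the scheme almost surely, then, almost surely, $Q(u^{n+1})=Q(u^n)$ for all $0\le n\le N-1$, where $Q(u)=\int_{\mathbb R}|u|^2\,dx$. -/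

import Mathlib

open MeasureTheory ProbabilityTheory TemperedDistribution
open scoped NNReal ENNReal SchwartzMap Laplacian

noncomputable section

namespace MidpointNLS

/-- The linear subspace of `L²(ℝ; ℂ)` of the functions of Sobolev regularity `s`, that is, of
those `f` for which `(1 + |ξ|²)^{s/2} 𝓕 f` is square integrable. -/
def sobolevSubmodule (s : ℝ) : Submodule ℂ (Lp ℂ 2 (volume : Measure ℝ)) where
  carrier := {f | MemSobolev s 2 (f : 𝓢'(ℝ, ℂ))}
  zero_mem' := by
    have h : ((0 : Lp ℂ 2 (volume : Measure ℝ)) : 𝓢'(ℝ, ℂ)) = 0 :=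
      map_zero (Lp.toTemperedDistributionCLM ℂ volume 2)
    simp only [Set.mem_ofPred_eq, h, memSobolev_fun_zero]
  add_mem' := by
    intro f g hf hg
    have h : ((f + g : Lp ℂ 2 (volume : Measure ℝ)) : 𝓢'(ℝ, ℂ)) = (f : 𝓢'(ℝ, ℂ)) + g :=
      map_add (Lp.toTemperedDistributionCLM ℂ volume 2) f g
    simp only [Set.mem_ofPred_eq] at hf hg ⊢
    rw [h]
    exact hf.add hg
  smul_mem' := by
    intro c f hf
    have h : ((c • f : Lp ℂ 2 (volume : Measure ℝ)) : 𝓢'(ℝ, ℂ)) = c • (f : 𝓢'(ℝ, ℂ)) :=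
      map_smul (Lp.toTemperedDistributionCLM ℂ volume 2) c f
    simp only [Set.mem_ofPred_eq] at hf ⊢
    rw [h]
    exact hf.smul c

/-- The Sobolev space `H^s(ℝ; ℂ)`, for `s ≥ 0`. It is a type of its own because it carries the
`H^s` norm and not the norm of `L²`. -/
def Sobolev (s : ℝ) : Type := sobolevSubmodule s

instance (s : ℝ) : AddCommGroup (Sobolev s) :=
  inferInstanceAs (AddCommGroup (sobolevSubmodule s))

instance (s : ℝ) : Module ℂ (Sobolev s) :=
  inferInstanceAs (Module ℂ (sobolevSubmodule s))

/-- The inclusion `H^s(ℝ; ℂ) ⊆ L²(ℝ; ℂ)`. -/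
def toL2 {s : ℝ} : Sobolev s →ₗ[ℂ] Lp ℂ 2 (volume : Measure ℝ) :=
  (sobolevSubmodule s).subtype

theorem toL2_injective {s : ℝ} : Function.Injective (toL2 (s := s)) :=
  Subtype.val_injective

theorem toL2_memSobolev {s : ℝ} (f : Sobolev s) : MemSobolev s 2 (toL2 f : 𝓢'(ℝ, ℂ)) :=
  f.2

theorem toTemperedDistribution_injective :
    Function.Injective (Lp.toTemperedDistributionCLM ℂ (volume : Measure ℝ) 2) :=
  LinearMap.ker_eq_bot.mp Lp.ker_toTemperedDistributionCLM_eq_bot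

/-- The function `𝓕⁻¹ (1 + |ξ|²)^{s/2} 𝓕 f` of `L²`. -/
def besselFun {s : ℝ} (f : Sobolev s) : Lp ℂ 2 (volume : Measure ℝ) :=
  Exists.choose (toL2_memSobolev f)

theorem besselFun_spec {s : ℝ} (f : Sobolev s) :
    Lp.toTemperedDistributionCLM ℂ volume 2 (besselFun f) =
      besselPotential ℝ ℂ s (Lp.toTemperedDistributionCLM ℂ volume 2 (toL2 f)) :=
  (Exists.choose_spec (toL2_memSobolev f)).symm

/-- The Bessel potential `𝓕⁻¹ (1 + |ξ|²)^{s/2} 𝓕` as a linear map from `H^s` to `L²`. -/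
def bessel (s : ℝ) : Sobolev s →ₗ[ℂ] Lp ℂ 2 (volume : Measure ℝ) where
  toFun f := besselFun f
  map_add' f g := by
    apply toTemperedDistribution_injective
    rw [map_add, besselFun_spec, besselFun_spec, besselFun_spec, map_add, map_add, map_add]
  map_smul' c f := by
    apply toTemperedDistribution_injective
    rw [RingHom.id_apply, map_smul, besselFun_spec, besselFun_spec, map_smul, map_smul, map_smul]

theorem bessel_spec {s : ℝ} (f : Sobolev s) :
    besselPotential ℝ ℂ s (toL2 f : 𝓢'(ℝ, ℂ)) = (bessel s f : 𝓢'(ℝ, ℂ)) :=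
  (besselFun_spec f).symm

theorem bessel_injective (s : ℝ) : Function.Injective (bessel s) := by
  intro f g h
  apply toL2_injective
  apply toTemperedDistribution_injective
  simp only [Lp.toTemperedDistributionCLM_apply]
  have hf := (besselPotential_neg_apply_eq_iff s _ _).mpr (bessel_spec f)
  have hg := (besselPotential_neg_apply_eq_iff s _ _).mpr (bessel_spec g)
  rw [← hf, ← hg, h]

/-- The `H^s` norm is `‖f‖ = ‖𝓕⁻¹ (1 + |ξ|²)^{s/2} 𝓕 f‖_{L²}`. -/
instance (s : ℝ) : NormedAddCommGroup (Sobolev s) :=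
  NormedAddCommGroup.induced (Sobolev s) (Lp ℂ 2 (volume : Measure ℝ)) (bessel s)
    (bessel_injective s)

instance (s : ℝ) : NormedSpace ℂ (Sobolev s) :=
  NormedSpace.induced ℂ (Sobolev s) (Lp ℂ 2 (volume : Measure ℝ)) (bessel s)

theorem norm_def {s : ℝ} (f : Sobolev s) : ‖f‖ = ‖bessel s f‖ := rfl

/-- The real part `p` of `u = p + i q`. -/
def realPart {s : ℝ} (u : Sobolev s) : Lp ℝ 2 (volume : Measure ℝ) :=
  Complex.reCLM.compLp (toL2 u)

/-- The imaginary part `q` of `u = p + i q`. -/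
def imagPart {s : ℝ} (u : Sobolev s) : Lp ℝ 2 (volume : Measure ℝ) :=
  Complex.imCLM.compLp (toL2 u)

/-- The charge `Q(u) = ∫ |u|² dx`. -/
def charge {s : ℝ} (u : Sobolev s) : ℝ :=
  ∫ x : ℝ, ‖toL2 u x‖ ^ 2

/-- The nonlinearity `g(z) = |z|^{2σ} z`. -/
def nonlin (σ : ℕ) (z : ℂ) : ℂ :=
  ((‖z‖ ^ (2 * σ) : ℝ) : ℂ) * z

/-- The value `(u + u') / 2`. -/
def midValue {s : ℝ} (u u' : Sobolev s) : Sobolev s :=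
  (1 / 2 : ℂ) • (u + u')

/-- One step of the mid-point scheme: with `m = (u + u') / 2`,
`i (u' - u) / δt + (δW / δt) Δ m + |m|^{2σ} m = 0` in the sense of tempered distributions,
that is, the equation holds when tested against every Schwartz function `φ`.
For `s > 1/2` the function `m` is bounded, so the last integral converges absolutely. -/
def IsMidpointStep {s : ℝ} (σ : ℕ) (δt δW : ℝ) (u u' : Sobolev s) : Prop :=
  ∀ φ : 𝓢(ℝ, ℂ),
    Complex.I * ((toL2 (u' - u) : 𝓢'(ℝ, ℂ)) φ / δt)
      + (δW / δt : ℝ) * (Δ (toL2 (midValue u u') : 𝓢'(ℝ, ℂ))) φ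
      + ∫ x : ℝ, φ x * nonlin σ (toL2 (midValue u u') x) = 0

/-- The time step `δt = T / N`. -/
def timeStep (T : ℝ≥0) (N : ℕ) : ℝ≥0 := T / N

/-- The grid point `t_n = n δt`. -/
def gridPoint (T : ℝ≥0) (N n : ℕ) : ℝ≥0 := n * timeStep T N

/-- The increment `δW_n = W(t_{n+1}) - W(t_n)`. -/
def increment {Ω : Type*} (W : ℝ≥0 → Ω → ℝ) (T : ℝ≥0) (N n : ℕ) (ω : Ω) : ℝ :=
  W (gridPoint T N (n + 1)) ω - W (gridPoint T N n) ω

/-- Along the path `ω`, the sequence `u⁰, …, u^N` solves the mid-point scheme. -/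
def SolvesScheme {s : ℝ} {Ω : Type*} (σ : ℕ) (W : ℝ≥0 → Ω → ℝ) (T : ℝ≥0) (N : ℕ) (ω : Ω)
    (u : ℕ → Sobolev s) : Prop :=
  ∀ n < N, IsMidpointStep σ (timeStep T N) (increment W T N n ω) (u n) (u (n + 1))

/-- Along the path `ω`, the maps `v ↦ Φ n v`, `0 ≤ n ≤ N`, are a phase flow of the mid-point
scheme on the set `D` of initial data: `Φ n v` is the value after `n` steps of a solution of the
scheme which starts in `v`. -/
structure IsSchemeFlow {s : ℝ} {Ω : Type*} (σ : ℕ) (W : ℝ≥0 → Ω → ℝ) (T : ℝ≥0) (N : ℕ) (ω : Ω)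
    (D : Set (Sobolev s)) (Φ : ℕ → Sobolev s → Sobolev s) : Prop where
  isOpen : IsOpen D
  initial : ∀ v ∈ D, Φ 0 v = v
  solves : ∀ v ∈ D, SolvesScheme σ W T N ω (fun n ↦ Φ n v)

/-- The two-form `∫ dp ∧ dq dx` on phase space for `p = Re Ψ` and `q = Im Ψ`, where `Ψ` is a
function of the initial datum `v`, evaluated at `v` on the tangent vectors `h`, `k`. Here `dp`
and `dq` are the Fréchet derivatives of `p` and `q` with respect to the initial datum. -/
def symplecticForm {s : ℝ} (Ψ : Sobolev s → Sobolev s) (v h k : Sobolev s) : ℝ :=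
  let dp := fderiv ℝ (fun w ↦ realPart (Ψ w)) v
  let dq := fderiv ℝ (fun w ↦ imagPart (Ψ w)) v
  ∫ x : ℝ, (dp h x * dq k x - dp k x * dq h x)

end MidpointNLS

end

/-!
Let `m = (u + u') / 2`. One step of the scheme is a linear Schrödinger step
`i (u' - u) + δW Δ m + δt b = 0` with a source `b ∈ L²`. The Laplacian is a Fourier multiplier
with a real symbol, hence symmetric on `L²`, so it disappears from the pairing of two such steps:
`i (⟪u₁', u₂'⟫ - ⟪u₁, u₂⟫) = δt (⟪b₁, m₂⟫ - ⟪m₁, b₂⟫)`.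

The scheme itself is the case `b = g(m)` with `g(z) = |z|^{2σ} z`. For the charge, pair a step with
itself: `⟪g(m), m⟫` is real.

The symplectic form on `(h, k)` is the imaginary part of the `L²` inner product of the derivatives
of the flow in the directions `h` and `k`. These derivatives again make such a step, with source
`g'(m) M`, where `M` is the mean of the two derivatives; since `g` is a gradient, `g'(m)` is
symmetric for the real part of the inner product, so that the real part of the right-hand side
vanishes. The scheme can be differentiated because `H^s ⊆ L^∞` for `s > 1/2` and `f ↦ g ∘ f` is
differentiable on `L^∞`.
-/

namespace MidpointNLS

section Distribution

open scoped ContDiff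

variable {E F : Type*} [NormedAddCommGroup E] [NormedSpace ℝ E]
  [MeasurableSpace E] [BorelSpace E] [NormedAddCommGroup F] [NormedSpace ℂ F] [CompleteSpace F]
  {μ : Measure E}

theorem toTemperedDistribution_congr_ae [μ.HasTemperateGrowth] {p q : ℝ≥0∞} [Fact (1 ≤ p)]
    [Fact (1 ≤ q)] {f : Lp F p μ} {g : Lp F q μ} (h : f =ᵐ[μ] g) :
    (f : 𝓢'(E, F)) = (g : 𝓢'(E, F)) := by
  ext φ
  rw [Lp.toTemperedDistribution_apply, Lp.toTemperedDistribution_apply]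
  exact integral_congr_ae (h.mono fun x hx ↦ congrArg (φ x • ·) hx)

variable [FiniteDimensional ℝ E]

theorem ae_eq_of_integral_schwartz_smul_eq {f g : E → F} (hf : LocallyIntegrable f μ)
    (hg : LocallyIntegrable g μ)
    (h : ∀ φ : 𝓢(E, ℂ), ∫ x, φ x • f x ∂μ = ∫ x, φ x • g x ∂μ) : f =ᵐ[μ] g := by
  refine ae_eq_of_integral_contDiff_smul_eq hf hg fun φ hφ hsupp ↦ ?_
  have hsupp' : HasCompactSupport (Complex.ofRealCLM ∘ φ) := hsupp.comp_left rfl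
  have hφ' : ContDiff ℝ ∞ (Complex.ofRealCLM ∘ φ) := by fun_prop
  simpa using h (hsupp'.toSchwartzMap hφ')

theorem ae_eq_smul_of_eq_smulLeftCLM [μ.HasTemperateGrowth] [IsLocallyFiniteMeasure μ]
    {p q : ℝ≥0∞} [Fact (1 ≤ p)] [Fact (1 ≤ q)] {a : E → ℂ} (ha : a.HasTemperateGrowth)
    {f : Lp F p μ} {g : Lp F q μ} (h : (g : 𝓢'(E, F)) = smulLeftCLM F a (f : 𝓢'(E, F))) :
    g =ᵐ[μ] fun x ↦ a x • f x := by
  have hf : LocallyIntegrable f μ := (Lp.memLp f).locallyIntegrable Fact.out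
  refine ae_eq_of_integral_schwartz_smul_eq ((Lp.memLp g).locallyIntegrable Fact.out) ?_
    fun φ ↦ ?_
  · exact locallyIntegrableOn_univ.1 <| (locallyIntegrableOn_univ.2 hf).continuousOn_smul
      isOpen_univ.isLocallyClosed ha.1.continuous.continuousOn
  · simpa [SchwartzMap.smulLeftCLM_apply_apply ha, smul_smul, mul_comm] using
      DFunLike.congr_fun h φ

end Distribution

section Fourier

open FourierTransform

variable {E F : Type*} [NormedAddCommGroup E] [InnerProductSpace ℝ E] [FiniteDimensional ℝ E]
  [MeasurableSpace E] [BorelSpace E] [NormedAddCommGroup F] [NormedSpace ℂ F]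

theorem continuous_fourierInv_of_integrable {f : E → F} (hf : Integrable f) :
    Continuous (𝓕⁻ f) := by
  have : 𝓕⁻ f = fun x ↦ 𝓕 f (-x) := funext (Real.fourierInv_eq_fourier_neg f)
  rw [this]
  exact (VectorFourier.fourierIntegral_continuous Real.continuous_fourierChar
    (innerSL ℝ).continuous₂ hf).comp continuous_neg

theorem smul_laplacian_eq_fourierMultiplierCLM (c : ℝ) (f : 𝓢'(E, F)) :
    (c : ℂ) • Δ f =
      fourierMultiplierCLM F (fun ξ : E ↦ ((c * (-(2 * Real.pi) ^ 2 * ‖ξ‖ ^ 2) : ℝ) : ℂ)) f := by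
  have hsymbol : (fun ξ : E ↦ ((c * (-(2 * Real.pi) ^ 2 * ‖ξ‖ ^ 2) : ℝ) : ℂ)) =
      ((c * -(2 * Real.pi) ^ 2 : ℝ) : ℂ) • fun ξ : E ↦ ((‖ξ‖ ^ 2 : ℝ) : ℂ) := by
    ext ξ
    simp only [Pi.smul_apply, smul_eq_mul, ← Complex.ofReal_mul, mul_assoc]
  rw [hsymbol, fourierMultiplierCLM_smul (by fun_prop), laplacian_eq_fourierMultiplierCLM,
    ← Complex.coe_smul, smul_smul, ← Complex.ofReal_mul]
  rfl

variable [CompleteSpace F]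

theorem integral_schwartz_smul_fourierInv {f : E → F} (hf : Integrable f) (φ : 𝓢(E, ℂ)) :
    ∫ x, φ x • 𝓕⁻ f x = ∫ ξ, (𝓕⁻ φ) ξ • f ξ := by
  have hφ (ξ : E) : (𝓕⁻ φ) ξ = VectorFourier.fourierIntegral 𝐞 volume (-innerₗ E) φ ξ := by
    rw [SchwartzMap.fourierInv_coe, Real.fourierInv_eq]
    simp [VectorFourier.fourierIntegral]
  have hf' (x : E) : 𝓕⁻ f x = VectorFourier.fourierIntegral 𝐞 volume (-innerₗ E).flip f x := by
    rw [Real.fourierInv_eq]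
    simp [VectorFourier.fourierIntegral, real_inner_comm]
  simp only [hφ, hf']
  exact (VectorFourier.integral_fourierIntegral_smul_eq_flip (μ := volume)
    (ν := volume) Real.continuous_fourierChar (by
      exact (continuous_inner (𝕜 := ℝ) (E := E)).neg) φ.integrable hf).symm

end Fourier

section FourierL2

open FourierTransform

variable {E F : Type*} [NormedAddCommGroup E] [InnerProductSpace ℝ E] [FiniteDimensional ℝ E]
  [MeasurableSpace E] [BorelSpace E] [NormedAddCommGroup F] [InnerProductSpace ℂ F]
  [CompleteSpace F]

theorem fourier_ae_eq_smul_of_eq_fourierMultiplierCLM {a : E → ℂ} (ha : a.HasTemperateGrowth)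
    {f g : Lp F 2 (volume : Measure E)}
    (h : (g : 𝓢'(E, F)) = fourierMultiplierCLM F a (f : 𝓢'(E, F))) :
    (𝓕 g : Lp F 2 (volume : Measure E)) =ᵐ[volume]
      fun ξ ↦ a ξ • (𝓕 f : Lp F 2 (volume : Measure E)) ξ := by
  refine ae_eq_smul_of_eq_smulLeftCLM ha ?_
  rw [← Lp.fourier_toTemperedDistribution_eq, ← Lp.fourier_toTemperedDistribution_eq, h,
    fourierMultiplierCLM_apply, fourier_fourierInv_eq]

theorem inner_eq_inner_of_eq_fourierMultiplierCLM {a : E → ℝ} (ha : a.HasTemperateGrowth)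
    {f₁ f₂ g₁ g₂ : Lp F 2 (volume : Measure E)}
    (h₁ : (g₁ : 𝓢'(E, F)) = fourierMultiplierCLM F (fun ξ ↦ (a ξ : ℂ)) (f₁ : 𝓢'(E, F)))
    (h₂ : (g₂ : 𝓢'(E, F)) = fourierMultiplierCLM F (fun ξ ↦ (a ξ : ℂ)) (f₂ : 𝓢'(E, F))) :
    inner ℂ g₁ f₂ = inner ℂ f₁ g₂ := by
  have ha' : (fun ξ ↦ (a ξ : ℂ)).HasTemperateGrowth := by fun_prop
  rw [← Lp.inner_fourier_eq g₁, ← Lp.inner_fourier_eq f₁, L2.inner_def, L2.inner_def]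
  refine integral_congr_ae ?_
  filter_upwards [fourier_ae_eq_smul_of_eq_fourierMultiplierCLM ha' h₁,
    fourier_ae_eq_smul_of_eq_fourierMultiplierCLM ha' h₂] with ξ hξ₁ hξ₂
  rw [hξ₁, hξ₂, inner_smul_left, inner_smul_right, Complex.conj_ofReal]

theorem ae_eq_fourierInv_fourier {f : Lp F 2 (volume : Measure E)}
    (hf : Integrable (𝓕 f : Lp F 2 (volume : Measure E))) :
    f =ᵐ[volume] 𝓕⁻ ((𝓕 f : Lp F 2 (volume : Measure E)) : E → F) := by
  refine ae_eq_of_integral_schwartz_smul_eq ((Lp.memLp f).locallyIntegrable one_le_two)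
    (continuous_fourierInv_of_integrable hf).locallyIntegrable fun φ ↦ ?_
  have hφ : (f : 𝓢'(E, F)) φ = ((𝓕 f : Lp F 2 (volume : Measure E)) : 𝓢'(E, F)) (𝓕⁻ φ) := by
    rw [← TemperedDistribution.fourierInv_apply, ← Lp.fourier_toTemperedDistribution_eq,
      fourierInv_fourier_eq]
  rw [integral_schwartz_smul_fourierInv hf]
  simpa only [Lp.toTemperedDistribution_apply] using hφ

theorem ae_norm_le_integral_norm_fourier {f : Lp F 2 (volume : Measure E)}
    (hf : Integrable (𝓕 f : Lp F 2 (volume : Measure E))) :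
    ∀ᵐ x, ‖f x‖ ≤ ∫ ξ, ‖(𝓕 f : Lp F 2 (volume : Measure E)) ξ‖ := by
  filter_upwards [ae_eq_fourierInv_fourier hf] with x hx
  rw [hx, Real.fourierInv_eq_fourier_neg]
  exact VectorFourier.norm_fourierIntegral_le_integral_norm _ _ _ _ _

end FourierL2

section SobolevEmbedding

open FourierTransform

theorem fourier_toL2_ae_eq {s : ℝ} (f : Sobolev s) :
    (𝓕 (toL2 f) : Lp ℂ 2 (volume : Measure ℝ)) =ᵐ[volume]
      fun ξ ↦ (((1 + ‖ξ‖ ^ 2) ^ (-s / 2) : ℝ) : ℂ) • (𝓕 (bessel s f) : Lp ℂ 2 volume) ξ :=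
  fourier_ae_eq_smul_of_eq_fourierMultiplierCLM (by fun_prop)
    ((besselPotential_neg_apply_eq_iff s _ _).2 (bessel_spec f)).symm

theorem norm_toL2_le {s : ℝ} (hs : 0 ≤ s) (f : Sobolev s) : ‖toL2 f‖ ≤ ‖f‖ := by
  rw [norm_def, ← Lp.norm_fourier_eq, ← Lp.norm_fourier_eq (bessel s f)]
  refine Lp.norm_le_norm_of_ae_le ?_
  filter_upwards [fourier_toL2_ae_eq f] with ξ hξ
  rw [hξ, norm_smul, Complex.norm_real, Real.norm_of_nonneg (by positivity)]
  exact mul_le_of_le_one_left (norm_nonneg _)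
    (Real.rpow_le_one_of_one_le_of_nonpos (by nlinarith [norm_nonneg ξ]) (by linarith))

/-- The inclusion `H^s ⊆ L²` as a continuous linear map, for `s ≥ 0`. -/
noncomputable def toL2CLM {s : ℝ} (hs : 0 ≤ s) : Sobolev s →L[ℂ] Lp ℂ 2 (volume : Measure ℝ) :=
  toL2.mkContinuous 1 fun f ↦ by simpa using norm_toL2_le hs f

theorem memLp_one_add_norm_sq_rpow {E : Type*} [NormedAddCommGroup E] [NormedSpace ℝ E]
    [FiniteDimensional ℝ E] [MeasurableSpace E] [BorelSpace E] (μ : Measure E)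
    [μ.IsAddHaarMeasure] {s : ℝ} (hs : Module.finrank ℝ E < 2 * s) :
    MemLp (fun ξ : E ↦ (((1 + ‖ξ‖ ^ 2) ^ (-s / 2) : ℝ) : ℂ)) 2 μ := by
  have hcont : Continuous fun ξ : E ↦ (((1 + ‖ξ‖ ^ 2) ^ (-s / 2) : ℝ) : ℂ) :=
    Complex.continuous_ofReal.comp <| .rpow_const (by fun_prop) fun ξ ↦ .inl (by positivity)
  rw [memLp_two_iff_integrable_sq_norm hcont.aestronglyMeasurable]
  refine (integrable_rpow_neg_one_add_norm_sq hs).congr (.of_forall fun ξ ↦ ?_)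
  beta_reduce
  rw [Complex.norm_real, Real.norm_of_nonneg (by positivity),
    ← Real.rpow_mul_natCast (by positivity)]
  congr 1
  push_cast
  ring

theorem exists_integral_norm_fourier_toL2_le {s : ℝ} (hs : 1 / 2 < s) :
    ∃ C : ℝ, ∀ f : Sobolev s, Integrable (𝓕 (toL2 f) : Lp ℂ 2 (volume : Measure ℝ)) ∧
      ∫ ξ, ‖(𝓕 (toL2 f) : Lp ℂ 2 (volume : Measure ℝ)) ξ‖ ≤ C * ‖f‖ := by
  have hmem := memLp_one_add_norm_sq_rpow (volume : Measure ℝ) (s := s) (by simp; linarith)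
  refine ⟨‖hmem.toLp‖, fun f ↦ ?_⟩
  let G : Lp ℂ 1 (volume : Measure ℝ) := hmem.toLp • (𝓕 (bessel s f) : Lp ℂ 2 volume)
  have hG : (𝓕 (toL2 f) : Lp ℂ 2 (volume : Measure ℝ)) =ᵐ[volume] G := by
    filter_upwards [fourier_toL2_ae_eq f, hmem.coeFn_toLp,
      Lp.coeFn_lpSMul (r := 1) hmem.toLp (𝓕 (bessel s f) : Lp ℂ 2 volume)] with ξ hf hb hs
    rw [hf, hs, Pi.smul_apply', hb]
  refine ⟨(L1.integrable_coeFn G).congr hG.symm, ?_⟩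
  calc ∫ ξ, ‖(𝓕 (toL2 f) : Lp ℂ 2 (volume : Measure ℝ)) ξ‖
      = ‖G‖ := by rw [L1.norm_eq_integral_norm, integral_congr_ae (hG.mono fun _ ↦ congrArg norm)]
    _ ≤ ‖hmem.toLp‖ * ‖(𝓕 (bessel s f) : Lp ℂ 2 (volume : Measure ℝ))‖ := Lp.norm_smul_le _ _
    _ = ‖hmem.toLp‖ * ‖f‖ := by rw [Lp.norm_fourier_eq, norm_def]

theorem exists_ae_norm_toL2_le {s : ℝ} (hs : 1 / 2 < s) :
    ∃ C : ℝ, ∀ f : Sobolev s, ∀ᵐ x, ‖toL2 f x‖ ≤ C * ‖f‖ := by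
  obtain ⟨C, hC⟩ := exists_integral_norm_fourier_toL2_le hs
  exact ⟨C, fun f ↦ (ae_norm_le_integral_norm_fourier (hC f).1).mono fun x hx ↦ hx.trans (hC f).2⟩

theorem memLp_top_toL2 {s : ℝ} (hs : 1 / 2 < s) (f : Sobolev s) : MemLp (toL2 f) ∞ volume :=
  let ⟨_, hC⟩ := exists_ae_norm_toL2_le hs
  memLp_top_of_bound (Lp.aestronglyMeasurable _) _ (hC f)

/-- The Sobolev embedding `H^s(ℝ) ⊆ L^∞(ℝ)` as a continuous linear map, for `s > 1/2`. -/
noncomputable def toLInfty {s : ℝ} (hs : 1 / 2 < s) :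
    Sobolev s →L[ℂ] Lp ℂ ∞ (volume : Measure ℝ) :=
  LinearMap.mkContinuousOfExistsBound
    { toFun f := (memLp_top_toL2 hs f).toLp
      map_add' f g := by
        rw [← MemLp.toLp_add]
        exact MemLp.toLp_congr _ _ (by rw [map_add]; exact Lp.coeFn_add _ _)
      map_smul' c f := by
        rw [RingHom.id_apply, ← MemLp.toLp_const_smul]
        exact MemLp.toLp_congr _ _ (by rw [map_smul]; exact Lp.coeFn_smul _ _) } <| by
    obtain ⟨C, hC⟩ := exists_ae_norm_toL2_le hs
    refine ⟨C, fun f ↦ ?_⟩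
    obtain ⟨x, hx⟩ := (hC f).exists
    exact (Lp.norm_toLp _ (memLp_top_toL2 hs f)).trans_le <| ENNReal.toReal_le_of_le_ofReal
      ((norm_nonneg _).trans hx) (eLpNormEssSup_le_of_ae_bound (hC f))

theorem coeFn_toLInfty {s : ℝ} (hs : 1 / 2 < s) (f : Sobolev s) :
    toLInfty hs f =ᵐ[volume] toL2 f :=
  (memLp_top_toL2 hs f).coeFn_toLp

end SobolevEmbedding

section Nemytskii

variable {α E F : Type*} [MeasurableSpace α] {μ : Measure α} [NormedAddCommGroup E]
  [NormedAddCommGroup F]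

theorem ae_norm_le_norm_of_top (f : Lp E ∞ μ) : ∀ᵐ x ∂μ, ‖f x‖ ≤ ‖f‖ := by
  filter_upwards [enorm_ae_le_eLpNormEssSup f μ] with x hx
  rw [← toReal_enorm, Lp.norm_def]
  exact ENNReal.toReal_mono (Lp.eLpNorm_ne_top f) hx

theorem memLp_top_comp [ProperSpace E] {g : E → F} (hg : Continuous g) (f : Lp E ∞ μ) :
    MemLp (g ∘ f) ∞ μ := by
  obtain ⟨C, hC⟩ := (isCompact_closedBall (0 : E) ‖f‖).exists_bound_of_continuousOn hg.continuousOn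
  refine memLp_top_of_bound (hg.comp_aestronglyMeasurable (Lp.aestronglyMeasurable f)) C ?_
  filter_upwards [ae_norm_le_norm_of_top f] with x hx
  exact hC _ (mem_closedBall_zero_iff.2 hx)

/-- The superposition (Nemytskii) operator `f ↦ g ∘ f` on `L^∞`. -/
noncomputable def nemytskii [ProperSpace E] {g : E → F} (hg : Continuous g) (f : Lp E ∞ μ) :
    Lp F ∞ μ :=
  (memLp_top_comp hg f).toLp

theorem coeFn_nemytskii [ProperSpace E] {g : E → F} (hg : Continuous g) (f : Lp E ∞ μ) :
    nemytskii hg f =ᵐ[μ] g ∘ f :=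
  (memLp_top_comp hg f).coeFn_toLp

variable [NormedSpace ℝ E] [NormedSpace ℝ F] [ProperSpace E]

theorem exists_forall_norm_sub_sub_fderiv_le {g : E → F} (hg : ContDiff ℝ 1 g) (R : ℝ) {ε : ℝ}
    (hε : 0 < ε) :
    ∃ δ > 0, ∀ z h, ‖z‖ ≤ R → ‖h‖ < δ → ‖g (z + h) - g z - fderiv ℝ g z h‖ ≤ ε * ‖h‖ := by
  have hunif := (isCompact_closedBall (0 : E) R).uniformContinuousAt_of_continuousAt (fderiv ℝ g)
    (fun z _ ↦ (hg.continuous_fderiv one_ne_zero).continuousAt) (Metric.dist_mem_uniformity hε)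
  obtain ⟨δ, hδ, hunif⟩ := Metric.mem_uniformity_dist.1 hunif
  refine ⟨δ, hδ, fun z h hz hh ↦ ?_⟩
  have hfderiv : ∀ w ∈ Metric.ball z δ, ‖fderiv ℝ g w - fderiv ℝ g z‖ ≤ ε := fun w hw ↦ by
    rw [← dist_eq_norm, dist_comm]
    exact (hunif (Metric.mem_ball'.1 hw) (mem_closedBall_zero_iff.2 hz)).le
  simpa using (convex_ball z δ).norm_image_sub_le_of_norm_fderiv_le'
    (fun w _ ↦ hg.differentiable one_ne_zero w) hfderiv (Metric.mem_ball_self hδ)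
    (y := z + h) (by simpa using hh)

theorem hasFDerivAt_nemytskii {g : E → F} (hg : ContDiff ℝ 1 g) (f : Lp E ∞ μ) :
    HasFDerivAt (nemytskii hg.continuous)
      ((ContinuousLinearMap.id ℝ (E →L[ℝ] F)).holderL μ ∞ ∞ ∞
        (nemytskii (hg.continuous_fderiv one_ne_zero) f)) f := by
  rw [hasFDerivAt_iff_isLittleO_nhds_zero, Asymptotics.isLittleO_iff]
  intro ε hε
  obtain ⟨δ, hδ, hg'⟩ := exists_forall_norm_sub_sub_fderiv_le hg ‖f‖ hε
  filter_upwards [Metric.ball_mem_nhds 0 hδ] with h hh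
  refine Lp.norm_le_mul_norm_of_ae_le_mul ?_
  set B := nemytskii (hg.continuous_fderiv one_ne_zero) f
  filter_upwards [ae_norm_le_norm_of_top f, ae_norm_le_norm_of_top h, Lp.coeFn_add f h,
    Lp.coeFn_sub (nemytskii hg.continuous (f + h) - nemytskii hg.continuous f)
      ((ContinuousLinearMap.id ℝ (E →L[ℝ] F)).holderL μ ∞ ∞ ∞ B h),
    Lp.coeFn_sub (nemytskii hg.continuous (f + h)) (nemytskii hg.continuous f),
    coeFn_nemytskii hg.continuous (f + h), coeFn_nemytskii hg.continuous f,
    coeFn_nemytskii (hg.continuous_fderiv one_ne_zero) f,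
    (ContinuousLinearMap.id ℝ (E →L[ℝ] F)).coeFn_holder (r := ∞) B h]
    with x hf hh' hadd hsub hsub' hgfh hgf hB hholder
  have hholder' : ((ContinuousLinearMap.id ℝ (E →L[ℝ] F)).holderL μ ∞ ∞ ∞ B h) x = B x (h x) :=
    hholder
  rw [hsub, Pi.sub_apply, hsub', Pi.sub_apply, hgfh, hgf, hholder', hB, Function.comp_apply,
    Function.comp_apply, Function.comp_apply, hadd]
  exact hg' _ _ hf (hh'.trans_lt (mem_ball_zero_iff.1 hh))

end Nemytskii

section ForcedStep

open Complex Topology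

variable {E F : Type*} [NormedAddCommGroup E] [InnerProductSpace ℝ E] [FiniteDimensional ℝ E]
  [MeasurableSpace E] [BorelSpace E] [NormedAddCommGroup F] [NormedSpace ℂ F]
  [CompleteSpace F]

/-- One step of the mid-point scheme in which a given source `b` stands in place of the nonlinear
term. Both the scheme and its linearization along a family of solutions are of this form. -/
def IsForcedStep (δt δW : ℝ) (u u' : Lp F 2 (volume : Measure E)) (b : 𝓢'(E, F)) : Prop :=
  (I / δt) • ((u' - u : Lp F 2 (volume : Measure E)) : 𝓢'(E, F)) +
    (δW / δt : ℂ) • Δ (((1 / 2 : ℂ) • (u + u') : Lp F 2 (volume : Measure E)) : 𝓢'(E, F)) +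
      b = 0

variable {δt δW : ℝ} {u u' : Lp F 2 (volume : Measure E)}

theorem isForcedStep_iff {b : 𝓢'(E, F)} :
    IsForcedStep δt δW u u' b ↔ ∀ φ : 𝓢(E, ℂ),
      (I / δt) • ((u' - u : Lp F 2 (volume : Measure E)) : 𝓢'(E, F)) φ +
        (δW / δt : ℂ) • (((1 / 2 : ℂ) • (u + u') : Lp F 2 (volume : Measure E)) : 𝓢'(E, F)) (Δ φ) +
          b φ = 0 := by
  simp only [IsForcedStep, ← laplacian_apply_apply]
  exact UniformConvergenceCLM.ext_iff

theorem IsForcedStep.eq_smul_laplacian (hδ : δt ≠ 0) {b : Lp F 2 (volume : Measure E)}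
    (h : IsForcedStep δt δW u u' (b : 𝓢'(E, F))) :
    ((-(I • (u' - u) + (δt : ℂ) • b) : Lp F 2 (volume : Measure E)) : 𝓢'(E, F)) =
      (δW : ℂ) • Δ (((1 / 2 : ℂ) • (u + u') : Lp F 2 (volume : Measure E)) : 𝓢'(E, F)) := by
  have hδ' : (δt : ℂ) ≠ 0 := ofReal_ne_zero.2 hδ
  rw [IsForcedStep] at h
  generalize (1 / 2 : ℂ) • (u + u') = m at h ⊢
  have hsource := congrArg ((δt : ℂ) • ·) h
  simp only [smul_add, smul_smul, mul_div_cancel₀ _ hδ', smul_zero] at hsource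
  simp only [← Lp.toTemperedDistributionCLM_apply, map_neg, map_add, map_smul] at hsource ⊢
  rw [neg_eq_iff_add_eq_zero, ← hsource]
  abel

theorem IsForcedStep.of_hasFDerivAt {X : Type*} [NormedAddCommGroup X] [NormedSpace ℝ X]
    {p : ℝ≥0∞} [Fact (1 ≤ p)] {U U' : X → Lp F 2 (volume : Measure E)}
    {B : X → Lp F p (volume : Measure E)} {A A' : X →L[ℝ] Lp F 2 (volume : Measure E)}
    {C : X →L[ℝ] Lp F p (volume : Measure E)} {v : X} (hU : HasFDerivAt U A v)
    (hU' : HasFDerivAt U' A' v) (hB : HasFDerivAt B C v)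
    (h : ∀ᶠ w in 𝓝 v, IsForcedStep δt δW (U w) (U' w) (B w : 𝓢'(E, F))) (k : X) :
    IsForcedStep δt δW (A k) (A' k) (C k : 𝓢'(E, F)) := by
  let pairing (q : ℝ≥0∞) [Fact (1 ≤ q)] (φ : 𝓢(E, ℂ)) :
      Lp F q (volume : Measure E) →L[ℝ] F :=
    ((PointwiseConvergenceCLM.evalCLM (RingHom.id ℂ) F φ).comp
      (Lp.toTemperedDistributionCLM F volume q)).restrictScalars ℝ
  refine isForcedStep_iff.2 fun φ ↦ ?_
  have hdiff := ((pairing 2 φ).hasFDerivAt.comp v (hU'.sub hU)).const_smul (I / δt : ℂ)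
  have hmid := ((pairing 2 (Δ φ)).hasFDerivAt.comp v
    ((hU.add hU').const_smul (1 / 2 : ℂ))).const_smul (δW / δt : ℂ)
  have hderiv := (hdiff.add hmid).add ((pairing p φ).hasFDerivAt.comp v hB)
  have hzero := hderiv.unique <| (hasFDerivAt_const (0 : F) v).congr_of_eventuallyEq <|
    h.mono fun w hw ↦ isForcedStep_iff.1 hw φ
  exact DFunLike.congr_fun hzero k

end ForcedStep

section ForcedStepInner

open Complex

variable {E F : Type*} [NormedAddCommGroup E] [InnerProductSpace ℝ E] [FiniteDimensional ℝ E]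
  [MeasurableSpace E] [BorelSpace E] [NormedAddCommGroup F] [InnerProductSpace ℂ F]
  [CompleteSpace F] {δt δW : ℝ} {u u' u₁ u₁' u₂ u₂' : Lp F 2 (volume : Measure E)}

/-- The Laplacian drops out because it is symmetric. -/
theorem IsForcedStep.inner_sub_inner (hδ : δt ≠ 0) {b₁ b₂ : Lp F 2 (volume : Measure E)}
    (h₁ : IsForcedStep δt δW u₁ u₁' (b₁ : 𝓢'(E, F)))
    (h₂ : IsForcedStep δt δW u₂ u₂' (b₂ : 𝓢'(E, F))) :
    I * (inner ℂ u₁' u₂' - inner ℂ u₁ u₂) =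
      δt * (inner ℂ b₁ ((1 / 2 : ℂ) • (u₂ + u₂')) - inner ℂ ((1 / 2 : ℂ) • (u₁ + u₁')) b₂) := by
  have hsymm := inner_eq_inner_of_eq_fourierMultiplierCLM (by fun_prop)
    ((h₁.eq_smul_laplacian hδ).trans (smul_laplacian_eq_fourierMultiplierCLM δW _))
    ((h₂.eq_smul_laplacian hδ).trans (smul_laplacian_eq_fourierMultiplierCLM δW _))
  simp only [inner_neg_left, inner_neg_right, inner_add_left, inner_add_right, inner_smul_left,
    inner_smul_right, conj_I, conj_ofReal, inner_sub_left, inner_sub_right, map_div₀, map_one,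
    map_ofNat] at hsymm ⊢
  linear_combination hsymm

theorem IsForcedStep.norm_eq (hδ : δt ≠ 0) {b : Lp F 2 (volume : Measure E)}
    (h : IsForcedStep δt δW u u' (b : 𝓢'(E, F)))
    (hb : (inner ℂ b ((1 / 2 : ℂ) • (u + u'))).im = 0) : ‖u'‖ = ‖u‖ := by
  have hinner := h.inner_sub_inner hδ h
  rw [← inner_conj_symm _ b, conj_eq_iff_im.2 hb, sub_self, mul_zero, mul_eq_zero,
    or_iff_right I_ne_zero, sub_eq_zero, inner_self_eq_norm_sq_to_K,
    inner_self_eq_norm_sq_to_K] at hinner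
  exact (sq_eq_sq₀ (norm_nonneg _) (norm_nonneg _)).1 (by exact_mod_cast hinner)

theorem IsForcedStep.im_inner_eq (hδ : δt ≠ 0) {b₁ b₂ : Lp F 2 (volume : Measure E)}
    (h₁ : IsForcedStep δt δW u₁ u₁' (b₁ : 𝓢'(E, F)))
    (h₂ : IsForcedStep δt δW u₂ u₂' (b₂ : 𝓢'(E, F)))
    (hb : (inner ℂ b₁ ((1 / 2 : ℂ) • (u₂ + u₂'))).re =
      (inner ℂ ((1 / 2 : ℂ) • (u₁ + u₁')) b₂).re) :
    (inner ℂ u₁' u₂').im = (inner ℂ u₁ u₂).im := by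
  have hinner := congrArg re (h₁.inner_sub_inner hδ h₂)
  rw [I_mul_re, re_ofReal_mul, sub_re, hb, sub_self, mul_zero, sub_im, neg_eq_zero,
    sub_eq_zero] at hinner
  exact hinner

end ForcedStepInner

section Nonlinearity

open Complex

theorem nonlin_eq_smul (σ : ℕ) : nonlin σ = fun z ↦ (‖z‖ ^ 2) ^ σ • z := by
  ext z
  simp [nonlin, pow_mul]

theorem contDiff_nonlin (σ : ℕ) : ContDiff ℝ 1 (nonlin σ) := by
  rw [nonlin_eq_smul]
  exact ((contDiff_norm_sq ℝ).pow σ).smul contDiff_id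

theorem fderiv_nonlin_apply (σ : ℕ) (z w : ℂ) :
    fderiv ℝ (nonlin σ) z w =
      (‖z‖ ^ 2) ^ σ • w + (σ * (‖z‖ ^ 2) ^ (σ - 1) * (2 * inner ℝ z w)) • z := by
  have h := (((hasFDerivAt_id (𝕜 := ℝ) z).norm_sq).pow σ).smul (hasFDerivAt_id (𝕜 := ℝ) z)
  have hnonlin : nonlin σ = fun y ↦ (‖id y‖ ^ 2) ^ σ • id y := nonlin_eq_smul σ
  rw [hnonlin]
  refine (DFunLike.congr_fun h.fderiv w).trans ?_
  simp [mul_add]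

/-- The derivative is symmetric because `nonlin σ` is the gradient of
`z ↦ ‖z‖ ^ (2 * σ + 2) / (2 * σ + 2)`. -/
theorem inner_fderiv_nonlin_comm (σ : ℕ) (z v w : ℂ) :
    inner ℝ (fderiv ℝ (nonlin σ) z v) w = inner ℝ v (fderiv ℝ (nonlin σ) z w) := by
  simp only [fderiv_nonlin_apply, inner_add_left, inner_add_right, inner_smul_left,
    inner_smul_right, real_inner_comm v z, conj_trivial]
  ring

variable {α : Type*} [MeasurableSpace α] {μ : Measure α}

/-- The product `|m|^{2σ} f` in `L²`. It is the nonlinear term of the scheme when `f ∈ L²` and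
`m ∈ L^∞` are the same function. -/
noncomputable def normPowSMulLp (σ : ℕ) (m : Lp ℂ ∞ μ) (f : Lp ℂ 2 μ) : Lp ℂ 2 μ :=
  nemytskii (g := fun z : ℂ ↦ ‖z‖ ^ (2 * σ)) (by fun_prop) m • f

/-- The linearization `g'(m) f` in `L²` of the superposition operator of `g = nonlin σ`, at a
bounded function `m`. -/
noncomputable def fderivNonlinLp (σ : ℕ) (m : Lp ℂ ∞ μ) (f : Lp ℂ 2 μ) : Lp ℂ 2 μ :=
  (ContinuousLinearMap.id ℝ (ℂ →L[ℝ] ℂ)).holder 2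
    (nemytskii ((contDiff_nonlin σ).continuous_fderiv one_ne_zero) m) f

theorem coeFn_normPowSMulLp (σ : ℕ) (m : Lp ℂ ∞ μ) (f : Lp ℂ 2 μ) :
    normPowSMulLp σ m f =ᵐ[μ] fun x ↦ ‖m x‖ ^ (2 * σ) • f x := by
  have hcont : Continuous fun z : ℂ ↦ ‖z‖ ^ (2 * σ) := by fun_prop
  filter_upwards [Lp.coeFn_lpSMul (r := 2) (nemytskii hcont m) f, coeFn_nemytskii hcont m]
    with x hsmul hm
  rw [normPowSMulLp, hsmul, Pi.smul_apply', hm, Function.comp_apply]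

theorem coeFn_fderivNonlinLp (σ : ℕ) (m : Lp ℂ ∞ μ) (f : Lp ℂ 2 μ) :
    fderivNonlinLp σ m f =ᵐ[μ] fun x ↦ fderiv ℝ (nonlin σ) (m x) (f x) := by
  have hcont := (contDiff_nonlin σ).continuous_fderiv one_ne_zero
  filter_upwards [(ContinuousLinearMap.id ℝ (ℂ →L[ℝ] ℂ)).coeFn_holder (r := 2)
    (nemytskii hcont m) f, coeFn_nemytskii hcont m] with x hholder hm
  rw [fderivNonlinLp, hholder, ContinuousLinearMap.id_apply, hm, Function.comp_apply]

theorem im_inner_normPowSMulLp_self (σ : ℕ) (m : Lp ℂ ∞ μ) (f : Lp ℂ 2 μ) :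
    (inner ℂ (normPowSMulLp σ m f) f).im = 0 := by
  rw [L2.inner_def, ← RCLike.im_eq_complex_im, ← integral_im (L2.integrable_inner _ _)]
  refine integral_eq_zero_of_ae ?_
  filter_upwards [coeFn_normPowSMulLp σ m f] with x hx
  rw [hx, inner_smul_left_eq_smul, RCLike.smul_im, inner_self_im, mul_zero, Pi.zero_apply]

theorem re_inner_fderivNonlinLp_comm (σ : ℕ) (m : Lp ℂ ∞ μ) (f₁ f₂ : Lp ℂ 2 μ) :
    (inner ℂ (fderivNonlinLp σ m f₁) f₂).re = (inner ℂ f₁ (fderivNonlinLp σ m f₂)).re := by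
  rw [L2.inner_def, L2.inner_def]
  simp only [← RCLike.re_eq_complex_re]
  rw [← integral_re (L2.integrable_inner _ _), ← integral_re (L2.integrable_inner _ _)]
  refine integral_congr_ae ?_
  filter_upwards [coeFn_fderivNonlinLp σ m f₁, coeFn_fderivNonlinLp σ m f₂] with x h₁ h₂
  rw [h₁, h₂]
  exact inner_fderiv_nonlin_comm σ _ _ _

end Nonlinearity

section Conservation

open Complex Topology

variable {s : ℝ} {σ : ℕ} {δt δW : ℝ} {u u' : Sobolev s}

theorem toL2_midValue (u u' : Sobolev s) :
    toL2 (midValue u u') = (1 / 2 : ℂ) • (toL2 u + toL2 u') := by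
  rw [midValue, map_smul, map_add]

theorem IsMidpointStep.isForcedStep (hs : 1 / 2 < s) (h : IsMidpointStep σ δt δW u u') :
    IsForcedStep δt δW (toL2 u) (toL2 u')
      (nemytskii (contDiff_nonlin σ).continuous (toLInfty hs (midValue u u')) : 𝓢'(ℝ, ℂ)) := by
  refine isForcedStep_iff.2 fun φ ↦ (Eq.trans ?_ (h φ))
  rw [laplacian_apply_apply, ← map_sub, ← toL2_midValue, Lp.toTemperedDistribution_apply
    (nemytskii _ _)]
  congr 1
  · simp only [smul_eq_mul]
    push_cast
    ring
  · refine integral_congr_ae ?_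
    filter_upwards [coeFn_nemytskii (contDiff_nonlin σ).continuous (toLInfty hs (midValue u u')),
      coeFn_toLInfty hs (midValue u u')] with x hnonlin hm
    rw [hnonlin, Function.comp_apply, hm, smul_eq_mul]

theorem charge_eq_norm_sq (u : Sobolev s) : charge u = ‖toL2 u‖ ^ 2 := by
  have hinner := inner_self_eq_norm_sq_to_K (𝕜 := ℂ) (toL2 u)
  rw [L2.inner_def] at hinner
  simp only [inner_self_eq_norm_sq_to_K] at hinner
  rw [charge, ← Complex.ofReal_inj, ← integral_complex_ofReal]
  exact_mod_cast hinner

theorem IsMidpointStep.charge_eq (hs : 1 / 2 < s) (hδ : δt ≠ 0)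
    (h : IsMidpointStep σ δt δW u u') : charge u' = charge u := by
  let m := midValue u u'
  have hsource : (nemytskii (contDiff_nonlin σ).continuous (toLInfty hs m) : 𝓢'(ℝ, ℂ)) =
      (normPowSMulLp σ (toLInfty hs m) (toL2 m) : 𝓢'(ℝ, ℂ)) := by
    refine toTemperedDistribution_congr_ae ?_
    filter_upwards [coeFn_nemytskii (contDiff_nonlin σ).continuous (toLInfty hs m),
      coeFn_normPowSMulLp σ (toLInfty hs m) (toL2 m), coeFn_toLInfty hs m] with x hg hb hm
    rw [hg, hb, Function.comp_apply, hm, nonlin, real_smul]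
  have hstep := h.isForcedStep hs
  rw [hsource] at hstep
  rw [charge_eq_norm_sq, charge_eq_norm_sq, hstep.norm_eq hδ]
  rw [← toL2_midValue]
  exact im_inner_normPowSMulLp_self σ _ _

theorem IsMidpointStep.isForcedStep_fderiv {X : Type*} [NormedAddCommGroup X] [NormedSpace ℝ X]
    (hs : 1 / 2 < s) {Ψ Ψ' : X → Sobolev s} {A A' : X →L[ℝ] Sobolev s} {v : X}
    (hΨ : HasFDerivAt Ψ A v) (hΨ' : HasFDerivAt Ψ' A' v)
    (h : ∀ᶠ w in 𝓝 v, IsMidpointStep σ δt δW (Ψ w) (Ψ' w)) (k : X) :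
    IsForcedStep δt δW (toL2 (A k)) (toL2 (A' k))
      (fderivNonlinLp σ (toLInfty hs (midValue (Ψ v) (Ψ' v)))
        (toL2 (midValue (A k) (A' k))) : 𝓢'(ℝ, ℂ)) := by
  have hs₀ : 0 ≤ s := by linarith
  have hcont := (contDiff_nonlin σ).continuous_fderiv one_ne_zero
  let m := toLInfty hs (midValue (Ψ v) (Ψ' v))
  let M := midValue (A k) (A' k)
  let toL2ℝ := (toL2CLM hs₀).restrictScalars ℝ
  have hderiv : (fderivNonlinLp σ m (toL2 M) : 𝓢'(ℝ, ℂ)) =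
      ((ContinuousLinearMap.id ℝ (ℂ →L[ℝ] ℂ)).holder ∞ (nemytskii hcont m) (toLInfty hs M) :
        𝓢'(ℝ, ℂ)) := by
    refine toTemperedDistribution_congr_ae ?_
    filter_upwards [coeFn_fderivNonlinLp σ m (toL2 M),
      (ContinuousLinearMap.id ℝ (ℂ →L[ℝ] ℂ)).coeFn_holder (r := ∞) (nemytskii hcont m)
        (toLInfty hs M), coeFn_nemytskii hcont m, coeFn_toLInfty hs M]
      with x hfderiv hholder hm hM
    rw [hfderiv, hholder, ContinuousLinearMap.id_apply, hm, hM, Function.comp_apply]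
  have hmid : HasFDerivAt (fun w ↦ midValue (Ψ w) (Ψ' w)) ((1 / 2 : ℂ) • (A + A')) v :=
    (hΨ.add hΨ').const_smul (1 / 2 : ℂ)
  have hsource := (hasFDerivAt_nemytskii (contDiff_nonlin σ) m).comp v
    (((toLInfty hs).restrictScalars ℝ).hasFDerivAt.comp v hmid)
  rw [hderiv]
  exact IsForcedStep.of_hasFDerivAt (p := ∞) (toL2ℝ.hasFDerivAt.comp v hΨ)
    (toL2ℝ.hasFDerivAt.comp v hΨ') hsource (h.mono fun w hw ↦ hw.isForcedStep hs) k

theorem fderiv_compLp_toL2_apply (hs : 0 ≤ s) (L : ℂ →L[ℝ] ℝ) {X : Type*}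
    [NormedAddCommGroup X] [NormedSpace ℝ X] {Ψ : X → Sobolev s} {v : X}
    (hΨ : DifferentiableAt ℝ Ψ v) (h : X) :
    fderiv ℝ (fun w ↦ L.compLp (toL2 (Ψ w))) v h = L.compLp (toL2 (fderiv ℝ Ψ v h)) :=
  DFunLike.congr_fun (((L.compLpL 2 (volume : Measure ℝ)).comp
    ((toL2CLM hs).restrictScalars ℝ)).hasFDerivAt.comp v hΨ.hasFDerivAt).fderiv h

theorem symplecticForm_eq_im_inner (hs : 0 ≤ s) {Ψ : Sobolev s → Sobolev s} {v : Sobolev s}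
    (hΨ : DifferentiableAt ℝ Ψ v) (h k : Sobolev s) :
    symplecticForm Ψ v h k =
      (inner ℂ (toL2 (fderiv ℝ Ψ v h)) (toL2 (fderiv ℝ Ψ v k))).im := by
  rw [L2.inner_def, ← RCLike.im_eq_complex_im, ← integral_im (L2.integrable_inner _ _)]
  simp only [symplecticForm, realPart, imagPart, fderiv_compLp_toL2_apply hs _ hΨ]
  refine integral_congr_ae ?_
  filter_upwards [reCLM.coeFn_compLp (toL2 (fderiv ℝ Ψ v h)),
    reCLM.coeFn_compLp (toL2 (fderiv ℝ Ψ v k)), imCLM.coeFn_compLp (toL2 (fderiv ℝ Ψ v h)),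
    imCLM.coeFn_compLp (toL2 (fderiv ℝ Ψ v k))] with x hre_h hre_k him_h him_k
  simp only [hre_h, hre_k, him_h, him_k, reCLM_apply, imCLM_apply, RCLike.inner_apply,
    RCLike.im_eq_complex_im, mul_im, conj_re, conj_im]
  ring

theorem symplecticForm_eq_of_isMidpointStep (hs : 1 / 2 < s) (hδ : δt ≠ 0)
    {Ψ Ψ' : Sobolev s → Sobolev s} {v : Sobolev s} (hΨ : DifferentiableAt ℝ Ψ v)
    (hΨ' : DifferentiableAt ℝ Ψ' v)
    (h : ∀ᶠ w in 𝓝 v, IsMidpointStep σ δt δW (Ψ w) (Ψ' w)) :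
    symplecticForm Ψ' v = symplecticForm Ψ v := by
  ext k₁ k₂
  rw [symplecticForm_eq_im_inner (by linarith) hΨ, symplecticForm_eq_im_inner (by linarith) hΨ']
  have hstep := IsMidpointStep.isForcedStep_fderiv hs hΨ.hasFDerivAt hΨ'.hasFDerivAt h
  refine (hstep k₁).im_inner_eq hδ (hstep k₂) ?_
  rw [← toL2_midValue, ← toL2_midValue]
  exact re_inner_fderivNonlinLp_comm σ _ _ _

theorem timeStep_pos {T : ℝ≥0} (hT : 0 < T) {N : ℕ} (hN : 0 < N) : 0 < timeStep T N :=
  div_pos hT (Nat.cast_pos.2 hN)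

end Conservation

end MidpointNLS

theorem mainTheorem7_general
    {Ω : Type*} (W : ℝ≥0 → Ω → ℝ) {s : ℝ} (hs : 1 / 2 < s) (σ : ℕ) {T : ℝ≥0} (hT : 0 < T)
    (N : ℕ) (ω : Ω) :
    (∀ (D : Set (MidpointNLS.Sobolev s)) (Φ : ℕ → MidpointNLS.Sobolev s → MidpointNLS.Sobolev s),
      MidpointNLS.IsSchemeFlow σ W T N ω D Φ → ∀ n < N, ∀ v ∈ D,
        DifferentiableAt ℝ (Φ n) v → DifferentiableAt ℝ (Φ (n + 1)) v →
        MidpointNLS.symplecticForm (Φ (n + 1)) v = MidpointNLS.symplecticForm (Φ n) v) ∧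
    (∀ u : ℕ → MidpointNLS.Sobolev s, MidpointNLS.SolvesScheme σ W T N ω u → ∀ n < N,
      MidpointNLS.charge (u (n + 1)) = MidpointNLS.charge (u n)) := by
  have hδ {n : ℕ} (hn : n < N) : (MidpointNLS.timeStep T N : ℝ) ≠ 0 :=
    NNReal.coe_ne_zero.2 (MidpointNLS.timeStep_pos hT (Nat.zero_lt_of_lt hn)).ne'
  refine ⟨fun D Φ hΦ n hn v hv hdiff hdiff' ↦ ?_, fun u hu n hn ↦ (hu n hn).charge_eq hs (hδ hn)⟩
  exact MidpointNLS.symplecticForm_eq_of_isMidpointStep hs (hδ hn) hdiff hdiff' <|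
    Filter.mem_of_superset (hΦ.isOpen.mem_nhds hv) fun w hw ↦ hΦ.solves w hw n hn

theorem mainTheorem7
    {Ω : Type*} [MeasurableSpace Ω] (P : Measure Ω) [IsProbabilityMeasure P]
    (W : ℝ≥0 → Ω → ℝ) (hW : IsBrownianReal W P)
    (s : ℝ) (hs : 1 / 2 < s) (σ : ℕ) (hσ : σ ≤ 2)
    (T : ℝ≥0) (hT : 0 < T) (N : ℕ) (hN : 0 < N) :
    -- the symplectic structure is preserved
    (∀ (D : Ω → Set (MidpointNLS.Sobolev s))
        (u : ℕ → Ω → MidpointNLS.Sobolev s → MidpointNLS.Sobolev s),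
      (∀ᵐ ω ∂P, MidpointNLS.IsSchemeFlow σ W T N ω (D ω) (fun n ↦ u n ω)) →
      ∀ᵐ ω ∂P, ∀ n < N, ∀ v ∈ D ω,
        DifferentiableAt ℝ (u n ω) v → DifferentiableAt ℝ (u (n + 1) ω) v →
        MidpointNLS.symplecticForm (u (n + 1) ω) v = MidpointNLS.symplecticForm (u n ω) v) ∧
    -- the charge is preserved
    (∀ u : ℕ → Ω → MidpointNLS.Sobolev s,
      (∀ᵐ ω ∂P, MidpointNLS.SolvesScheme σ W T N ω (fun n ↦ u n ω)) →
      ∀ᵐ ω ∂P, ∀ n < N,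
        MidpointNLS.charge (u (n + 1) ω) = MidpointNLS.charge (u n ω)) :=
  ⟨fun D u hu ↦ hu.mono fun ω hω ↦ (mainTheorem7_general W hs σ hT N ω).1 (D ω) (fun n ↦ u n ω) hω,
    fun u hu ↦ hu.mono fun ω hω ↦ (mainTheorem7_general W hs σ hT N ω).2 (fun n ↦ u n ω) hω⟩
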